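/- Let $n\ge 2$ and let $\mathcal O_n$ be the Cuntz algebra, i.e. a (nonzero, unital) $C^*$-algebra generated by $n$ isometries $S_1,\dots,S_n$ satisfying $\sum_{i=1}^n S_iS_i^*=1$. A multi-index is a finite word $\mu=\mu_1\cdots\mu_k$ with letters in $\{1,\dots,n\}$ ($k\ge 0$; the empty word is allowed), of length $|\mu|=k$; put $S_\mu=S_{\mu_1}\cdots S_{\mu_k}$ (with $S_\emptyset=1$) and $P_\mu=S_\mu S_\mu^*$. Let $\mathcal D_n\subseteq\mathcal O_n$ be the $C^*$-subalgebra generated by all the projections $P_\mu$. Every nonzero projection $q\in\mathcal D_n$ has a unique representation $q=\sum_{j=1}^r P_{\mu_j}$ (up to order) with $r\ge1$ minimal among all representations of $q$ as a finite sum of projections of the form $P_\mu$; it is called the standard form of $q$, and $\min(q):=\min_{1\le j\le r}|\mu_j|$. A unital $*$-endomorphism $\alpha$ of $\mathcal O_n$ is called modestly scaling if for every sequence $(\nu_k)_{k\ge1}$ of non-empty multi-indices the following holds: if $p\in\mathcal O_n$ is a projection with $p\le\alpha(P_{\nu_1\cdots\nu_k})$ for all $k\ge 1$, then $p=0$. (Here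 $\nu_1\cdots\nu_k$ denotes concatenation.) Proposition. Let $\alpha$ be a unital $*$-endomorphism of $\mathcal O_n$ with $\alpha(\mathcal D_n)\subseteq\mathcal D_n$. Then the following two conditions are equivalent: (i) $\alpha$ is modestly scaling; (ii) for every sequence $(\nu_k)_{k\ge1}$ of non-empty multi-indices, $\min\bigl(\alpha(P_{\nu_1\cdots\nu_k})\bigr)\to\infty$ as $k\to\infty$. -/

import Mathlib

open Filter

namespace CuntzAlg

/-- The family `S` of elements of the C⋆-algebra `A` presents `A` as the Cuntz algebra `𝒪ₙ`:
the `Sᵢ` are isometries, `∑ᵢ Sᵢ Sᵢ⋆ = 1`, and `A` is generated by them as a C⋆-algebra.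
(It is used for `2 ≤ n` and nonzero `A`.) -/
structure IsCuntzFamily {A : Type*} [CStarAlgebra A] {n : ℕ} (S : Fin n → A) : Prop where
  isometry : ∀ i, star (S i) * S i = 1
  sum_range : ∑ i, S i * star (S i) = 1
  generates : (StarAlgebra.adjoin ℂ (Set.range S)).topologicalClosure = ⊤

/-- `S_μ = S_{μ₁} ⋯ S_{μₖ}` for a multi-index `μ = μ₁…μₖ`, with `S_∅ = 1`.
Multi-indices are the finite words `List (Fin n)`. -/
def wordIsometry {A : Type*} [CStarAlgebra A] {n : ℕ} (S : Fin n → A) (μ : List (Fin n)) : A :=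
  (μ.map S).prod

/-- The range projection `P_μ = S_μ S_μ⋆`. -/
def wordProj {A : Type*} [CStarAlgebra A] {n : ℕ} (S : Fin n → A) (μ : List (Fin n)) : A :=
  wordIsometry S μ * star (wordIsometry S μ)

/-- The diagonal `𝒟ₙ`: the C⋆-subalgebra generated by all the projections `P_μ`. -/
noncomputable def diagonal {A : Type*} [CStarAlgebra A] {n : ℕ} (S : Fin n → A) :
    StarSubalgebra ℂ A :=
  (StarAlgebra.adjoin ℂ (Set.range (wordProj S))).topologicalClosure

/-- `q = ∑_{μ ∈ M} P_μ`, the sum being taken over the finite family (multiset) `M` of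
multi-indices. -/
def IsRepresentation {A : Type*} [CStarAlgebra A] {n : ℕ} (S : Fin n → A) (q : A)
    (M : Multiset (List (Fin n))) : Prop :=
  (M.map (wordProj S)).sum = q

/-- `M` is the standard form of `q`: a representation of `q` as a finite sum of projections `P_μ`
whose number of summands is minimal among all such representations. -/
def IsStandardForm {A : Type*} [CStarAlgebra A] {n : ℕ} (S : Fin n → A) (q : A)
    (M : Multiset (List (Fin n))) : Prop :=
  IsRepresentation S q M ∧ ∀ M', IsRepresentation S q M' → M.card ≤ M'.card

/-- `min(q)`: the least length of a multi-index occurring in the standard form of `q`. It is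
meaningful for nonzero projections `q` in the diagonal, which have exactly one standard form, and
that one is not empty. -/
noncomputable def minLength {A : Type*} [CStarAlgebra A] {n : ℕ} (S : Fin n → A) (q : A) : ℕ :=
  sInf {l : ℕ | ∃ M, IsStandardForm S q M ∧ ∃ μ ∈ M, μ.length = l}

/-- The concatenation `ν₀ν₁…νₖ` of the first `k + 1` terms of a sequence of multi-indices
(which is indexed from `0` here). -/
def concat {n : ℕ} (ν : ℕ → List (Fin n)) (k : ℕ) : List (Fin n) :=
  (List.range (k + 1)).flatMap ν

/-- A unital ⋆-endomorphism `α` is modestly scaling if for every sequence `ν` of non-empty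
multi-indices, the only projection dominated by all `α(P_{ν₀…νₖ})` is zero. -/
def IsModestlyScaling {A : Type*} [CStarAlgebra A] [PartialOrder A] {n : ℕ} (S : Fin n → A)
    (α : A →⋆ₐ[ℂ] A) : Prop :=
  ∀ ν : ℕ → List (Fin n), (∀ k, ν k ≠ []) →
    ∀ p : A, IsStarProjection p → (∀ k, p ≤ α (wordProj S (concat ν k))) → p = 0

end CuntzAlg

/-! Write q_k = α(P_{ν₀…νₖ}), a decreasing sequence of nonzero diagonal projections. Two facts link
`minLength` to order: `min(q)` is the length of some cylinder P_μ ≤ q (`exists_wordProj_le`), and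
P_μ ≤ q forces `min(q)` ≤ |μ| (`minLength_le`).

(i) ⇒ (ii): only finitely many words are shorter than L, and modest scaling applied to p = P_μ shows
that each such P_μ eventually leaves q_k.

(ii) ⇒ (i): let p ≤ q_k for all k. Given μ, take k with `min(q_k)` > |μ|; then P_μ is not below q_k.
Since q_k contains or is orthogonal to every small enough cylinder, some P_{μσ} is orthogonal to
q_k, and so p S_{μσ} = 0. Thus p kills a dense family of cylinders. As p need not lie in the
diagonal, p = 0 requires an argument (`eq_zero_of_forall_exists_mul_eq_zero`): averaging over the
gauge action is faithful, and on polynomials in the generators it equals, up to the factor 2π,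
compression a ↦ w⋆aw by isometries w that can be chosen with pw = 0. The gauge action is realised
inside C(𝕋, A), without a universal property, by lifting each element along evaluation at 1
(`exists_gauge_lift`). -/

namespace CuntzAlg

/-! ### Words, their isometries and cylinder projections. -/

section Words

variable {A : Type*} [CStarAlgebra A] {n : ℕ} {S : Fin n → A}

/-- The isometries `Sᵢ` have mutually orthogonal ranges. -/
def IsOrthonormal (S : Fin n → A) : Prop :=
  ∀ i j, star (S i) * S j = if i = j then 1 else 0

/-- Compressing ∑ S_k S_k⋆ = 1 by S_j writes 1 as a sum of positive terms, of which the term k = j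
is already 1; the others must vanish. -/
theorem IsCuntzFamily.isOrthonormal [PartialOrder A] [StarOrderedRing A]
    (hS : IsCuntzFamily S) : IsOrthonormal S := by
  intro i j
  split_ifs with hij
  · exact hij ▸ hS.isometry i
  have hsum : ∑ k, star (star (S k) * S j) * (star (S k) * S j) = 1 := by
    calc ∑ k, star (star (S k) * S j) * (star (S k) * S j)
        = ∑ k, star (S j) * (S k * star (S k)) * S j := by simp [mul_assoc]
      _ = star (S j) * (∑ k, S k * star (S k)) * S j := by
          rw [Finset.mul_sum, Finset.sum_mul]
      _ = 1 := by rw [hS.sum_range, mul_one, hS.isometry]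
  rw [← Finset.add_sum_erase _ _ (Finset.mem_univ j), hS.isometry] at hsum
  simp only [star_one, mul_one, add_eq_left] at hsum
  rw [Finset.sum_eq_zero_iff_of_nonneg fun _ _ => star_mul_self_nonneg _] at hsum
  exact CStarRing.star_mul_self_eq_zero_iff _ |>.1
    (hsum i (Finset.mem_erase.2 ⟨hij, Finset.mem_univ i⟩))

@[simp] theorem wordIsometry_nil : wordIsometry S [] = 1 := rfl

theorem wordIsometry_cons (i : Fin n) (μ : List (Fin n)) :
    wordIsometry S (i :: μ) = S i * wordIsometry S μ := by
  simp [wordIsometry]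

theorem wordIsometry_append (μ ν : List (Fin n)) :
    wordIsometry S (μ ++ ν) = wordIsometry S μ * wordIsometry S ν := by
  simp [wordIsometry]

theorem IsOrthonormal.star_mul_self (hS : IsOrthonormal S) (μ : List (Fin n)) :
    star (wordIsometry S μ) * wordIsometry S μ = 1 := by
  induction μ with
  | nil => simp
  | cons i μ ih =>
    rw [wordIsometry_cons, star_mul, mul_assoc, ← mul_assoc _ (S i), hS, if_pos rfl, one_mul, ih]

theorem IsOrthonormal.star_mul_append (hS : IsOrthonormal S) (μ ν : List (Fin n)) :
    star (wordIsometry S μ) * wordIsometry S (μ ++ ν) = wordIsometry S ν := by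
  rw [wordIsometry_append, ← mul_assoc, hS.star_mul_self, one_mul]

theorem IsOrthonormal.star_append_mul (hS : IsOrthonormal S) (μ ν : List (Fin n)) :
    star (wordIsometry S (μ ++ ν)) * wordIsometry S μ = star (wordIsometry S ν) := by
  rw [wordIsometry_append, star_mul, mul_assoc, hS.star_mul_self, mul_one]

theorem IsOrthonormal.star_mul_eq_zero (hS : IsOrthonormal S) {μ ν : List (Fin n)}
    (h₁ : ¬ μ <+: ν) (h₂ : ¬ ν <+: μ) : star (wordIsometry S μ) * wordIsometry S ν = 0 := by
  induction μ generalizing ν with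
  | nil => exact absurd List.nil_prefix h₁
  | cons i μ ih =>
    cases ν with
    | nil => exact absurd List.nil_prefix h₂
    | cons j ν =>
      rw [wordIsometry_cons, wordIsometry_cons, star_mul, mul_assoc, ← mul_assoc _ (S j), hS]
      split_ifs with hij
      · subst hij
        rw [one_mul]
        exact ih (fun h => h₁ (by simpa using h)) (fun h => h₂ (by simpa using h))
      · simp

theorem wordProj_nil : wordProj S [] = 1 := by simp [wordProj]

theorem IsOrthonormal.isStarProjection (hS : IsOrthonormal S) (μ : List (Fin n)) :
    IsStarProjection (wordProj S μ) where
  isIdempotentElem := by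
    rw [IsIdempotentElem, wordProj, mul_assoc, ← mul_assoc (star _), hS.star_mul_self, one_mul]
  isSelfAdjoint := by simp [IsSelfAdjoint, wordProj]

theorem IsOrthonormal.proj_mul_append (hS : IsOrthonormal S) (μ ν : List (Fin n)) :
    wordProj S μ * wordProj S (μ ++ ν) = wordProj S (μ ++ ν) := by
  rw [wordProj, wordProj, mul_assoc, ← mul_assoc (star _), hS.star_mul_append, ← mul_assoc,
    ← wordIsometry_append]

theorem IsOrthonormal.append_mul_proj (hS : IsOrthonormal S) (μ ν : List (Fin n)) :
    wordProj S (μ ++ ν) * wordProj S μ = wordProj S (μ ++ ν) := by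
  simpa [(hS.isStarProjection _).isSelfAdjoint.star_eq] using
    congrArg star (hS.proj_mul_append μ ν)

theorem IsOrthonormal.proj_mul_eq_zero (hS : IsOrthonormal S) {μ ν : List (Fin n)}
    (h₁ : ¬ μ <+: ν) (h₂ : ¬ ν <+: μ) : wordProj S μ * wordProj S ν = 0 := by
  rw [wordProj, wordProj, mul_assoc, ← mul_assoc (star _), hS.star_mul_eq_zero h₁ h₂]
  simp

theorem IsOrthonormal.proj_commute (hS : IsOrthonormal S) (μ ν : List (Fin n)) :
    Commute (wordProj S μ) (wordProj S ν) := by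
  by_cases h₁ : μ <+: ν
  · obtain ⟨κ, rfl⟩ := h₁
    exact (hS.proj_mul_append μ κ).trans (hS.append_mul_proj μ κ).symm
  by_cases h₂ : ν <+: μ
  · obtain ⟨κ, rfl⟩ := h₂
    exact (hS.append_mul_proj ν κ).trans (hS.proj_mul_append ν κ).symm
  · exact (hS.proj_mul_eq_zero h₁ h₂).trans (hS.proj_mul_eq_zero h₂ h₁).symm

/-- Since S_μ⋆ P_μ S_μ = 1 and α is unital, no simplicity of A or injectivity of α is needed. -/
theorem IsOrthonormal.map_wordProj_ne_zero [Nontrivial A] (hS : IsOrthonormal S)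
    (α : A →⋆ₐ[ℂ] A) (μ : List (Fin n)) : α (wordProj S μ) ≠ 0 := by
  intro h
  have e : star (wordIsometry S μ) * wordProj S μ * wordIsometry S μ = 1 := by
    rw [wordProj, ← mul_assoc, hS.star_mul_self, one_mul, hS.star_mul_self]
  have := congrArg α e
  simp [h] at this

theorem IsOrthonormal.wordProj_ne_zero [Nontrivial A] (hS : IsOrthonormal S)
    (μ : List (Fin n)) : wordProj S μ ≠ 0 :=
  hS.map_wordProj_ne_zero (StarAlgHom.id ℂ A) μ

theorem IsCuntzFamily.sum_wordProj (hS : IsCuntzFamily S) (μ : List (Fin n)) :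
    ∑ i, wordProj S (μ ++ [i]) = wordProj S μ := by
  have : ∀ i, wordProj S (μ ++ [i]) =
      wordIsometry S μ * (S i * star (S i)) * star (wordIsometry S μ) := by
    intro i
    simp [wordProj, wordIsometry_append, wordIsometry_cons, mul_assoc]
  simp_rw [this]
  rw [← Finset.sum_mul, ← Finset.mul_sum, hS.sum_range, mul_one, wordProj]

end Words

/-! ### Projections of the diagonal and small cylinders. -/

section Diagonal

variable {A : Type*} [CStarAlgebra A] {n : ℕ} {S : Fin n → A}

theorem wordProj_mem_diagonal (μ : List (Fin n)) : wordProj S μ ∈ diagonal S :=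
  StarSubalgebra.le_topologicalClosure _ (StarAlgebra.subset_adjoin ℂ _ ⟨μ, rfl⟩)

theorem IsOrthonormal.commute_of_mem_diagonal (hS : IsOrthonormal S) {q : A}
    (hq : q ∈ diagonal S) (μ : List (Fin n)) : Commute q (wordProj S μ) := by
  have hclosed : IsClosed {x : A | x * wordProj S μ = wordProj S μ * x} :=
    isClosed_eq (by fun_prop) (by fun_prop)
  have hsub : ((StarAlgebra.adjoin ℂ (Set.range (wordProj S)) : StarSubalgebra ℂ A) : Set A) ⊆
      {x : A | x * wordProj S μ = wordProj S μ * x} := by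
    intro x hx
    change Commute x (wordProj S μ)
    induction hx using StarAlgebra.adjoin_induction with
    | mem x hx => obtain ⟨ν, rfl⟩ := hx; exact hS.proj_commute ν μ
    | algebraMap r => exact Algebra.commutes r _
    | add x y _ _ hx hy => exact hx.add_left hy
    | mul x y _ _ hx hy => exact hx.mul_left hy
    | star x _ hx =>
      simpa [(hS.isStarProjection μ).isSelfAdjoint.star_eq] using hx.star_star
  exact closure_minimal hsub hclosed hq

/-- Elements of the algebraic diagonal act as scalars on all sufficiently small cylinders. -/
theorem IsOrthonormal.exists_scalar_of_mem_adjoin (hS : IsOrthonormal S) {d : A}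
    (hd : d ∈ StarAlgebra.adjoin ℂ (Set.range (wordProj S))) :
    ∃ k : ℕ, ∀ μ : List (Fin n), k ≤ μ.length →
      ∃ c : ℂ, d * wordProj S μ = c • wordProj S μ ∧ wordProj S μ * d = c • wordProj S μ := by
  induction hd using StarAlgebra.adjoin_induction with
  | mem x hx =>
    obtain ⟨ν, rfl⟩ := hx
    refine ⟨ν.length, fun μ hμ => ?_⟩
    by_cases h : ν <+: μ
    · obtain ⟨κ, rfl⟩ := h
      exact ⟨1, by simp [hS.proj_mul_append], by simp [hS.append_mul_proj]⟩
    · have h' : ¬ μ <+: ν := fun h' => h (h'.eq_of_length_le hμ ▸ List.prefix_rfl)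
      exact ⟨0, by simp [hS.proj_mul_eq_zero h h'], by simp [hS.proj_mul_eq_zero h' h]⟩
  | algebraMap r =>
    exact ⟨0, fun μ _ => ⟨r, by simp [Algebra.algebraMap_eq_smul_one]⟩⟩
  | add x y _ _ hx hy =>
    obtain ⟨k, hk⟩ := hx
    obtain ⟨l, hl⟩ := hy
    refine ⟨max k l, fun μ hμ => ?_⟩
    obtain ⟨c, hc, hc'⟩ := hk μ (le_trans (le_max_left _ _) hμ)
    obtain ⟨e, he, he'⟩ := hl μ (le_trans (le_max_right _ _) hμ)
    exact ⟨c + e, by rw [add_mul, hc, he, add_smul], by rw [mul_add, hc', he', add_smul]⟩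
  | mul x y _ _ hx hy =>
    obtain ⟨k, hk⟩ := hx
    obtain ⟨l, hl⟩ := hy
    refine ⟨max k l, fun μ hμ => ?_⟩
    obtain ⟨c, hc, hc'⟩ := hk μ (le_trans (le_max_left _ _) hμ)
    obtain ⟨e, he, he'⟩ := hl μ (le_trans (le_max_right _ _) hμ)
    refine ⟨c * e, ?_, ?_⟩
    · rw [mul_assoc, he, mul_smul_comm, hc, smul_smul, mul_comm]
    · rw [← mul_assoc, hc', smul_mul_assoc, he', smul_smul]
  | star x _ hx =>
    obtain ⟨k, hk⟩ := hx
    refine ⟨k, fun μ hμ => ?_⟩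
    obtain ⟨c, hc, hc'⟩ := hk μ hμ
    refine ⟨star c, ?_, ?_⟩
    · simpa [(hS.isStarProjection μ).isSelfAdjoint.star_eq] using congrArg star hc'
    · simpa [(hS.isStarProjection μ).isSelfAdjoint.star_eq] using congrArg star hc

/-- A projection in the diagonal either contains or is orthogonal to each sufficiently small
cylinder. -/
theorem IsOrthonormal.exists_level (hS : IsOrthonormal S) {q : A} (hq : q ∈ diagonal S)
    (hqq : IsStarProjection q) :
    ∃ k : ℕ, ∀ μ : List (Fin n), k ≤ μ.length →
      q * wordProj S μ = wordProj S μ ∨ q * wordProj S μ = 0 := by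
  obtain ⟨d, hd, hdist⟩ := Metric.mem_closure_iff.1
    (show q ∈ closure ((StarAlgebra.adjoin ℂ (Set.range (wordProj S)) : StarSubalgebra ℂ A) :
      Set A) from hq) (1 / 2) (by norm_num)
  obtain ⟨k, hk⟩ := hS.exists_scalar_of_mem_adjoin hd
  refine ⟨k, fun μ hμ => ?_⟩
  obtain ⟨c, hc, -⟩ := hk μ hμ
  rw [dist_eq_norm] at hdist
  have hcomm := (hS.commute_of_mem_diagonal hq μ).eq
  set P := wordProj S μ with hP
  have hPP : P * P = P := (hS.isStarProjection μ).isIdempotentElem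
  have hqi : q * q = q := hqq.isIdempotentElem
  by_contra! hcon
  obtain ⟨h1, h0⟩ := hcon
  -- With d acting on P as the scalar c, q - d acts as 1 - c on qP and as -c on P - qP. If both are
  -- nonzero, these scalars have modulus below 1/2, yet they differ by 1.
  have key : ∀ (x : A) (a : ℂ), x ≠ 0 → a • x = (q - d) * x → ‖a‖ < 1 / 2 := by
    intro x a hx h
    have h2 : ‖a‖ * ‖x‖ ≤ ‖q - d‖ * ‖x‖ := by
      rw [← norm_smul, h]; exact norm_mul_le _ _
    exact (le_of_mul_le_mul_right h2 (norm_pos_iff.2 hx)).trans_lt hdist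
  have hdP : ∀ x, P * x = x → d * x = c • x := by
    intro x hx
    rw [← hx, ← mul_assoc, hc, smul_mul_assoc]
  have e1 := key (q * P) (1 - c) h0 (by
    rw [sub_mul, hdP (q * P) (by rw [hcomm, ← mul_assoc, hPP]), ← mul_assoc, hqi, sub_smul,
      one_smul])
  have e2 := key (P - q * P) (-c) (sub_ne_zero.2 (Ne.symm h1)) (by
    rw [sub_mul, hdP (P - q * P) (by rw [mul_sub, hcomm, ← mul_assoc, hPP]), mul_sub,
      ← mul_assoc, hqi, sub_self, zero_sub, neg_smul])
  have : ‖(1 : ℂ)‖ ≤ ‖1 - c‖ + ‖-c‖ := by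
    calc ‖(1 : ℂ)‖ = ‖(1 - c) - (-c)‖ := by congr 1; ring
      _ ≤ _ := norm_sub_le _ _
  rw [norm_one] at this
  linarith

theorem IsCuntzFamily.exists_representation_mul (hS : IsCuntzFamily S) {q : A} (r : ℕ) :
    ∀ μ : List (Fin n), (∀ σ : List (Fin n), σ.length = r →
      q * wordProj S (μ ++ σ) = wordProj S (μ ++ σ) ∨ q * wordProj S (μ ++ σ) = 0) →
    ∃ M, IsRepresentation S (q * wordProj S μ) M := by
  induction r with
  | zero =>
    intro μ h
    rcases h [] rfl with h | h
    · rw [List.append_nil] at h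
      exact ⟨{μ}, by simp [IsRepresentation, h]⟩
    · rw [List.append_nil] at h
      exact ⟨0, by simp [IsRepresentation, h]⟩
  | succ r ih =>
    intro μ h
    have : ∀ i, ∃ M, IsRepresentation S (q * wordProj S (μ ++ [i])) M := fun i =>
      ih (μ ++ [i]) fun σ hσ => by simpa using h (i :: σ) (by simp [hσ])
    choose M hM using this
    refine ⟨∑ i, M i, ?_⟩
    simp only [IsRepresentation] at hM ⊢
    rw [← hS.sum_wordProj μ, Finset.mul_sum]
    simp_rw [← hM]
    change (Multiset.sumAddMonoidHom.comp (Multiset.mapAddMonoidHom (wordProj S))) (∑ i, M i) = _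
    rw [map_sum]
    rfl

/-- A cylinder not below q has a child not below q; r descents reach a level where orthogonality is
the only alternative. -/
theorem IsCuntzFamily.exists_append_mul_eq_zero (hS : IsCuntzFamily S) {q : A} (r : ℕ) :
    ∀ μ : List (Fin n), (∀ σ : List (Fin n), σ.length = r →
      q * wordProj S (μ ++ σ) = wordProj S (μ ++ σ) ∨ q * wordProj S (μ ++ σ) = 0) →
    q * wordProj S μ ≠ wordProj S μ →
    ∃ σ, q * wordProj S (μ ++ σ) = 0 := by
  induction r with
  | zero =>
    intro μ h hne
    rcases h [] rfl with h | h
    · rw [List.append_nil] at h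
      exact absurd h hne
    · exact ⟨[], h⟩
  | succ r ih =>
    intro μ h hne
    have : ∃ i, q * wordProj S (μ ++ [i]) ≠ wordProj S (μ ++ [i]) := by
      by_contra! hall
      apply hne
      rw [← hS.sum_wordProj μ, Finset.mul_sum]
      exact Finset.sum_congr rfl fun i _ => hall i
    obtain ⟨i, hi⟩ := this
    obtain ⟨σ, hσ⟩ := ih (μ ++ [i]) (fun σ hσ => by simpa using h (i :: σ) (by simp [hσ])) hi
    exact ⟨i :: σ, by simpa using hσ⟩

end Diagonal

/-! ### Standard forms and minimal length. -/

section StandardForm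

variable {A : Type*} [CStarAlgebra A] [PartialOrder A] [StarOrderedRing A] {n : ℕ} {S : Fin n → A}

theorem IsCuntzFamily.exists_isStandardForm (hS : IsCuntzFamily S) {q : A}
    (hq : q ∈ diagonal S) (hqq : IsStarProjection q) : ∃ M, IsStandardForm S q M := by
  obtain ⟨k, hk⟩ := hS.isOrthonormal.exists_level hq hqq
  obtain ⟨M, hM⟩ := hS.exists_representation_mul (q := q) k []
    fun σ hσ => by simpa using hk σ hσ.ge
  rw [wordProj_nil, mul_one] at hM
  obtain ⟨N, hN, hmin⟩ := WellFounded.has_min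
    (InvImage.wf Multiset.card (wellFounded_lt (α := ℕ))) {N | IsRepresentation S q N} ⟨M, hM⟩
  exact ⟨N, hN, fun M' hM' => not_lt.1 (hmin M' hM')⟩

theorem IsOrthonormal.le_of_isRepresentation (hS : IsOrthonormal S) {q : A}
    {M : Multiset (List (Fin n))} (hM : IsRepresentation S q M) {μ : List (Fin n)} (hμ : μ ∈ M) :
    wordProj S μ ≤ q := by
  rw [← hM]
  exact Multiset.single_le_sum
    (fun x hx => by
      obtain ⟨ν, -, rfl⟩ := Multiset.mem_map.1 hx
      exact (hS.isStarProjection ν).nonneg) _ (Multiset.mem_map_of_mem _ hμ)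

/-- The minimal length of a nonzero diagonal projection is attained by a cylinder below it. -/
theorem IsCuntzFamily.exists_wordProj_le (hS : IsCuntzFamily S) {q : A}
    (hq : q ∈ diagonal S) (hqq : IsStarProjection q) (h0 : q ≠ 0) :
    ∃ μ : List (Fin n), μ.length = minLength S q ∧ wordProj S μ ≤ q := by
  obtain ⟨M, hM⟩ := hS.exists_isStandardForm hq hqq
  -- A nonempty standard form makes the infimum in `minLength` attained, rather than the default 0
  -- of an empty set.
  have hne : M ≠ 0 := by
    rintro rfl
    exact h0 (by simpa [IsRepresentation] using hM.1.symm)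
  obtain ⟨μ, hμ⟩ := Multiset.exists_mem_of_ne_zero hne
  obtain ⟨N, hN, ν, hν, hlen⟩ := Nat.sInf_mem
    (s := {l : ℕ | ∃ M, IsStandardForm S q M ∧ ∃ μ ∈ M, μ.length = l}) ⟨_, M, hM, μ, hμ, rfl⟩
  exact ⟨ν, hlen, hS.isOrthonormal.le_of_isRepresentation hN.1 hν⟩

/-- If no summand of a standard form is indexed by a prefix of μ, each is either below P_μ or
orthogonal to it. Those below add up to P_μ, and replacing them by the single word μ keeps the form
minimal. Uniqueness of the standard form is not needed. -/
theorem IsCuntzFamily.minLength_le [Nontrivial A] (hS : IsCuntzFamily S) {q : A}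
    (hq : q ∈ diagonal S) (hqq : IsStarProjection q) {μ : List (Fin n)}
    (hμ : q * wordProj S μ = wordProj S μ) : minLength S q ≤ μ.length := by
  classical
  have hO := hS.isOrthonormal
  obtain ⟨M, hM⟩ := hS.exists_isStandardForm hq hqq
  by_cases hpre : ∃ ν ∈ M, ν <+: μ
  · obtain ⟨ν, hν, hνμ⟩ := hpre
    have : minLength S q ≤ ν.length := Nat.sInf_le ⟨M, hM, ν, hν, rfl⟩
    exact this.trans hνμ.length_le
  push Not at hpre
  have hsplit : ((M.filter (μ <+: ·)).map (wordProj S)).sum = wordProj S μ := by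
    have h1 : ((M.map (wordProj S)).map (· * wordProj S μ)).sum = wordProj S μ := by
      rw [Multiset.sum_map_mul_right, Multiset.map_id']
      exact (congrArg (· * wordProj S μ) hM.1).trans hμ
    rw [← Multiset.filter_add_not (μ <+: ·) M, Multiset.map_add, Multiset.map_add,
      Multiset.sum_add] at h1
    have h2 : (((M.filter (¬ μ <+: ·)).map (wordProj S)).map (· * wordProj S μ)).sum = 0 := by
      apply Multiset.sum_eq_zero
      intro x hx
      simp only [Multiset.map_map, Function.comp, Multiset.mem_map, Multiset.mem_filter] at hx
      obtain ⟨ν, ⟨hν, hμν⟩, rfl⟩ := hx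
      exact hO.proj_mul_eq_zero (hpre ν hν) hμν
    rw [h2, add_zero, Multiset.map_map] at h1
    rw [← h1]
    congr 1
    apply Multiset.map_congr rfl
    intro ν hν
    obtain ⟨κ, rfl⟩ := (Multiset.mem_filter.1 hν).2
    exact (hO.append_mul_proj μ κ).symm
  have hne : M.filter (μ <+: ·) ≠ 0 := by
    intro h
    rw [h] at hsplit
    exact hO.wordProj_ne_zero μ (by simpa using hsplit.symm)
  have hrep : IsRepresentation S q (μ ::ₘ M.filter (¬ μ <+: ·)) := by
    rw [IsRepresentation, Multiset.map_cons, Multiset.sum_cons, ← hsplit, ← Multiset.sum_add,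
      ← Multiset.map_add, Multiset.filter_add_not]
    exact hM.1
  have hcard : (μ ::ₘ M.filter (¬ μ <+: ·)).card ≤ M.card := by
    have h1 := congrArg Multiset.card (Multiset.filter_add_not (μ <+: ·) M)
    have h2 := Multiset.card_pos.2 hne
    rw [Multiset.card_add] at h1
    rw [Multiset.card_cons]
    omega
  exact Nat.sInf_le ⟨_, ⟨hrep, fun M' hM' => hcard.trans (hM.2 M' hM')⟩, μ,
    Multiset.mem_cons_self _ _, rfl⟩

end StandardForm

/-! ### The canonical endomorphism φ and wandering isometries. -/

section Shift

variable {A : Type*} [CStarAlgebra A] {n : ℕ} {S : Fin n → A}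

/-- The canonical endomorphism `x ↦ ∑ᵢ Sᵢ x Sᵢ⋆`. -/
def shift (S : Fin n → A) (x : A) : A := ∑ i, S i * x * star (S i)

theorem IsOrthonormal.shift_mul_apply (hO : IsOrthonormal S) (x : A) (i : Fin n) :
    shift S x * S i = S i * x := by
  rw [shift, Finset.sum_mul, Finset.sum_eq_single i]
  · rw [mul_assoc, hO, if_pos rfl, mul_one]
  · intro j _ hj
    rw [mul_assoc, hO, if_neg hj, mul_zero]
  · simp

theorem IsOrthonormal.shift_mul (hO : IsOrthonormal S) (x y : A) :
    shift S (x * y) = shift S x * shift S y := by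
  rw [shift.eq_def S y, Finset.mul_sum]
  refine Finset.sum_congr rfl fun i _ => ?_
  rw [← mul_assoc (shift S x), ← mul_assoc (shift S x), hO.shift_mul_apply, mul_assoc (S i) x y]

theorem shift_star (x : A) : shift S (star x) = star (shift S x) := by
  simp [shift, mul_assoc]

theorem IsCuntzFamily.shift_one (hS : IsCuntzFamily S) : shift S 1 = 1 := by
  simp [shift, hS.sum_range]

theorem IsOrthonormal.iterate_shift_mul (hO : IsOrthonormal S) (m : ℕ) (x y : A) :
    (shift S)^[m] (x * y) = (shift S)^[m] x * (shift S)^[m] y := by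
  induction m generalizing x y with
  | zero => rfl
  | succ m ih => simp only [Function.iterate_succ_apply, hO.shift_mul, ih]

theorem iterate_shift_star (m : ℕ) (x : A) :
    (shift S)^[m] (star x) = star ((shift S)^[m] x) := by
  induction m generalizing x with
  | zero => rfl
  | succ m ih => simp only [Function.iterate_succ_apply, shift_star, ih]

theorem IsCuntzFamily.iterate_shift_one (hS : IsCuntzFamily S) (m : ℕ) :
    (shift S)^[m] 1 = 1 :=
  Function.iterate_fixed hS.shift_one m

theorem iterate_shift_zero (m : ℕ) : (shift S)^[m] 0 = 0 :=
  Function.iterate_fixed (by simp [shift]) m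

theorem IsOrthonormal.iterate_shift_mul_wordIsometry (hO : IsOrthonormal S) (μ : List (Fin n))
    (k : ℕ) (x : A) : (shift S)^[μ.length + k] x * wordIsometry S μ =
      wordIsometry S μ * (shift S)^[k] x := by
  induction μ with
  | nil => simp
  | cons i μ ih =>
    rw [List.length_cons, Nat.add_right_comm, Function.iterate_succ_apply', wordIsometry_cons,
      ← mul_assoc, hO.shift_mul_apply, mul_assoc, ih, mul_assoc]

theorem IsOrthonormal.star_wordIsometry_mul_iterate_shift (hO : IsOrthonormal S)
    (μ : List (Fin n)) (k : ℕ) (x : A) : star (wordIsometry S μ) * (shift S)^[μ.length + k] x =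
      (shift S)^[k] x * star (wordIsometry S μ) := by
  have := congrArg star (hO.iterate_shift_mul_wordIsometry μ k (star x))
  simpa [iterate_shift_star] using this

/-- φ^m(x) is the sum of S_σ x S_σ⋆ over the words σ of length m. -/
theorem mul_iterate_shift_eq_zero {a x : A} {m : ℕ}
    (h : ∀ σ : List (Fin n), σ.length = m → a * (wordIsometry S σ * x) = 0) :
    a * (shift S)^[m] x = 0 := by
  induction m generalizing a with
  | zero => simpa using h [] rfl
  | succ m ih =>
    rw [Function.iterate_succ_apply', shift, Finset.mul_sum]
    refine Finset.sum_eq_zero fun i _ => ?_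
    have : a * S i * (shift S)^[m] x = 0 := ih fun σ hσ => by
      simpa [wordIsometry_cons, mul_assoc] using h (i :: σ) (by simp [hσ])
    rw [← mul_assoc, ← mul_assoc, this, zero_mul]

/-- The isometry `x` is orthogonal to its first `m` shifts. -/
structure IsWandering (S : Fin n → A) (m : ℕ) (x : A) : Prop where
  star_mul_self : star x * x = 1
  star_mul_shift : ∀ d, 1 ≤ d → d ≤ m → star x * (shift S)^[d] x = 0

/-- Compression by a shifted wandering isometry is the projection onto gauge degree zero. -/
theorem IsCuntzFamily.compress (hS : IsCuntzFamily S) (hO : IsOrthonormal S) {m : ℕ} {x : A}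
    (hx : IsWandering S m x) {μ ν : List (Fin n)} (hμ : μ.length ≤ m) (hν : ν.length ≤ m) :
    star ((shift S)^[m] x) * (wordIsometry S μ * star (wordIsometry S ν)) * (shift S)^[m] x =
      if μ.length = ν.length then wordIsometry S μ * star (wordIsometry S ν) else 0 := by
  obtain ⟨k, rfl⟩ := Nat.exists_eq_add_of_le hμ
  obtain ⟨l, hl⟩ := Nat.exists_eq_add_of_le hν
  -- Moving φ^m(x) past a word costs its length as shifts, leaving φ^k(x⋆)φ^l(x) in the middle. This
  -- is 1 if k = l; otherwise it is a shift of x⋆φ^d(x) or of its adjoint, with d = |k - l| ≤ m.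
  have e : star ((shift S)^[μ.length + k] x) *
      (wordIsometry S μ * star (wordIsometry S ν)) * (shift S)^[μ.length + k] x =
      wordIsometry S μ * ((shift S)^[k] (star x) * (shift S)^[l] x) *
        star (wordIsometry S ν) := by
    have h1 := hO.iterate_shift_mul_wordIsometry μ k (star x)
    have h2 := hO.star_wordIsometry_mul_iterate_shift ν l x
    rw [← hl] at h2
    rw [iterate_shift_star] at h1
    rw [mul_assoc, mul_assoc, h2, ← mul_assoc, h1]
    simp only [mul_assoc]
  rw [e]
  split_ifs with h
  · obtain rfl : k = l := by omega
    rw [← hO.iterate_shift_mul, hx.star_mul_self, hS.iterate_shift_one, mul_one]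
  · have key : (shift S)^[k] (star x) * (shift S)^[l] x = 0 := by
      rcases lt_or_gt_of_ne (show k ≠ l by omega) with hkl | hkl
      · obtain ⟨d, rfl⟩ := Nat.exists_eq_add_of_lt hkl
        rw [add_assoc, Function.iterate_add_apply, ← hO.iterate_shift_mul,
          hx.star_mul_shift _ (by omega) (by omega), iterate_shift_zero]
      · obtain ⟨d, rfl⟩ := Nat.exists_eq_add_of_lt hkl
        have h3 := congrArg star (hx.star_mul_shift (d + 1) (by omega) (by omega))
        rw [star_mul, star_star, star_zero, ← iterate_shift_star] at h3
        rw [add_assoc, Function.iterate_add_apply, ← hO.iterate_shift_mul, h3,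
          iterate_shift_zero]
    rw [key]
    simp

/-- At position |η| + m the first word has its final j, while in the second a shift by 1 ≤ |σ| ≤ m
puts a letter of the block iᵐ there. -/
theorem not_prefix_append_replicate {i j : Fin n} (hij : i ≠ j) {m : ℕ} (η σ : List (Fin n))
    (h1 : 1 ≤ σ.length) (h2 : σ.length ≤ m) :
    ¬ (η ++ (List.replicate m i ++ [j])) <+: σ ++ (η ++ (List.replicate m i ++ [j])) := by
  intro h
  have h3 := h.getElem (i := η.length + m) (by simp)
  rw [List.getElem_append_right (by omega), List.getElem_append_right (by simp),
    List.getElem_append_right (by omega), List.getElem_append_right (by omega),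
    List.getElem_append_left (by simp; omega)] at h3
  simp only [List.getElem_singleton, List.getElem_replicate] at h3
  exact hij h3.symm

theorem IsOrthonormal.isWandering (hO : IsOrthonormal S) {i j : Fin n} (hij : i ≠ j) (m : ℕ)
    (η : List (Fin n)) :
    IsWandering S m (wordIsometry S (η ++ (List.replicate m i ++ [j]))) where
  star_mul_self := hO.star_mul_self _
  star_mul_shift d h1 h2 := by
    refine mul_iterate_shift_eq_zero fun σ hσ => ?_
    subst hσ
    rw [← wordIsometry_append]
    apply hO.star_mul_eq_zero (not_prefix_append_replicate hij η σ h1 h2)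
    intro h
    have := h.length_le
    simp only [List.length_append] at this
    omega

/-- Annihilation persists under further extension, so the words of T can be treated one after
another. -/
theorem exists_uniform_extension {a : A}
    (ha : ∀ μ : List (Fin n), ∃ σ, a * wordIsometry S (μ ++ σ) = 0)
    (T : Finset (List (Fin n))) : ∃ η, ∀ σ ∈ T, a * wordIsometry S (σ ++ η) = 0 := by
  classical
  induction T using Finset.induction_on with
  | empty => exact ⟨[], by simp⟩
  | insert τ T _ ih =>
    obtain ⟨η, hη⟩ := ih
    obtain ⟨κ, hκ⟩ := ha (τ ++ η)
    refine ⟨η ++ κ, fun σ hσ => ?_⟩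
    rcases Finset.mem_insert.1 hσ with rfl | hσ
    · simpa using hκ
    · rw [← List.append_assoc, wordIsometry_append, ← mul_assoc, hη σ hσ, zero_mul]

theorem IsOrthonormal.exists_isWandering (hO : IsOrthonormal S) (hn : 2 ≤ n) {a : A}
    (ha : ∀ μ : List (Fin n), ∃ σ, a * wordIsometry S (μ ++ σ) = 0) (m : ℕ) :
    ∃ x, IsWandering S m x ∧ a * (shift S)^[m] x = 0 := by
  obtain ⟨η, hη⟩ := exists_uniform_extension ha (List.finite_length_eq (Fin n) m).toFinset
  refine ⟨_, hO.isWandering (i := ⟨0, by omega⟩) (j := ⟨1, by omega⟩) (by simp) m η,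
    mul_iterate_shift_eq_zero fun σ hσ => ?_⟩
  rw [← wordIsometry_append, ← List.append_assoc, wordIsometry_append, ← mul_assoc,
    hη σ (by simpa using hσ), zero_mul]

end Shift

/-! ### Gauge averaging over the circle and its faithfulness. -/

section Gauge

open Real MeasureTheory

variable {A : Type*} [CStarAlgebra A] {n : ℕ} {S : Fin n → A}

/-- The family `z ↦ z Sᵢ` in the algebra of continuous functions on the circle. -/
def gaugeFamily (S : Fin n → A) (i : Fin n) : C(Circle, A) :=
  ⟨fun z => (z : ℂ) • S i, by fun_prop⟩

theorem gaugeFamily_apply (i : Fin n) (z : Circle) : gaugeFamily S i z = (z : ℂ) • S i := rfl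

theorem IsOrthonormal.gaugeFamily (hO : IsOrthonormal S) : IsOrthonormal (gaugeFamily S) := by
  intro i j
  ext z
  have hz : (starRingEnd ℂ) (z : ℂ) * z = 1 := by
    rw [← Complex.normSq_eq_conj_mul_self, Circle.normSq_coe, Complex.ofReal_one]
  have := hO i j
  simp only [ContinuousMap.mul_apply, ContinuousMap.star_apply, gaugeFamily_apply, star_smul,
    smul_mul_smul_comm, this, RCLike.star_def, hz, one_smul]
  split_ifs <;> rfl

theorem wordIsometry_gaugeFamily_apply (μ : List (Fin n)) (z : Circle) :
    wordIsometry (gaugeFamily S) μ z = (z : ℂ) ^ μ.length • wordIsometry S μ := by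
  induction μ with
  | nil => simp
  | cons i μ ih =>
    rw [wordIsometry_cons, ContinuousMap.mul_apply, ih, gaugeFamily_apply, wordIsometry_cons,
      smul_mul_smul_comm, List.length_cons, pow_succ']

theorem IsOrthonormal.monomial_mul (hO : IsOrthonormal S) (μ ν κ τ : List (Fin n)) :
    (∃ μ' τ', (wordIsometry S μ * star (wordIsometry S ν)) *
      (wordIsometry S κ * star (wordIsometry S τ)) =
        wordIsometry S μ' * star (wordIsometry S τ')) ∨
    (wordIsometry S μ * star (wordIsometry S ν)) *
      (wordIsometry S κ * star (wordIsometry S τ)) = 0 := by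
  have e : (wordIsometry S μ * star (wordIsometry S ν)) *
      (wordIsometry S κ * star (wordIsometry S τ)) =
      wordIsometry S μ * (star (wordIsometry S ν) * wordIsometry S κ) *
        star (wordIsometry S τ) := by simp only [mul_assoc]
  rw [e]
  by_cases h₁ : ν <+: κ
  · obtain ⟨ρ, rfl⟩ := h₁
    exact Or.inl ⟨μ ++ ρ, τ, by rw [hO.star_mul_append, wordIsometry_append]⟩
  by_cases h₂ : κ <+: ν
  · obtain ⟨ρ, rfl⟩ := h₂
    exact Or.inl ⟨μ, τ ++ ρ, by
      rw [hO.star_append_mul, wordIsometry_append, star_mul, mul_assoc]⟩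
  · exact Or.inr (by rw [hO.star_mul_eq_zero h₁ h₂]; simp)

/-- Monomials S_μ S_ν⋆ together with 0 are closed under products, so they span. Only orthonormality
is assumed so that this applies to `gaugeFamily S` as well. -/
theorem IsOrthonormal.adjoin_induction (hO : IsOrthonormal S) {p : A → Prop}
    (monomial : ∀ μ ν, p (wordIsometry S μ * star (wordIsometry S ν)))
    (zero : p 0) (add : ∀ x y, p x → p y → p (x + y)) (smul : ∀ (c : ℂ) x, p x → p (c • x))
    {a : A} (ha : a ∈ StarAlgebra.adjoin ℂ (Set.range S)) : p a := by
  have hspan : a ∈ Submodule.span ℂ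
      (Submonoid.closure (Set.range S ∪ star (Set.range S)) : Set A) := by
    rw [← StarAlgebra.adjoin_eq_span]
    exact ha
  clear ha
  induction hspan using Submodule.span_induction with
  | zero => exact zero
  | add x y _ _ hx hy => exact add x y hx hy
  | smul c x _ hx => exact smul c x hx
  | mem x hx =>
    have : (∃ μ ν, x = wordIsometry S μ * star (wordIsometry S ν)) ∨ x = 0 := by
      induction hx using Submonoid.closure_induction with
      | one => exact Or.inl ⟨[], [], by simp⟩
      | mem x hx =>
        rcases hx with ⟨i, rfl⟩ | ⟨i, hi⟩
        · exact Or.inl ⟨[i], [], by simp [wordIsometry_cons]⟩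
        · exact Or.inl ⟨[], [i], by simp [wordIsometry_cons, hi]⟩
      | mul x y _ _ hx hy =>
        rcases hx with ⟨μ, ν, rfl⟩ | rfl
        · rcases hy with ⟨κ, τ, rfl⟩ | rfl
          · exact hO.monomial_mul μ ν κ τ
          · exact Or.inr (mul_zero _)
        · exact Or.inr (zero_mul _)
    rcases this with ⟨μ, ν, rfl⟩ | rfl
    · exact monomial μ ν
    · exact zero

/-- The unnormalized mean of a function over the circle. -/
noncomputable def circleMean (f : C(Circle, A)) : A := ∫ t in (-π)..π, f (Circle.exp t)

theorem continuous_comp_exp (f : C(Circle, A)) : Continuous fun t : ℝ => f (Circle.exp t) := by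
  fun_prop

theorem circleMean_add (f g : C(Circle, A)) : circleMean (f + g) = circleMean f + circleMean g :=
  intervalIntegral.integral_add ((continuous_comp_exp f).intervalIntegrable _ _)
    ((continuous_comp_exp g).intervalIntegrable _ _)

theorem circleMean_smul (c : ℂ) (f : C(Circle, A)) : circleMean (c • f) = c • circleMean f :=
  intervalIntegral.integral_smul c _

theorem circleMean_zero : circleMean (0 : C(Circle, A)) = 0 := by
  simpa using circleMean_smul (0 : ℂ) (0 : C(Circle, A))

theorem norm_circleMean_le (f : C(Circle, A)) : ‖circleMean f‖ ≤ 2 * π * ‖f‖ := by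
  have := intervalIntegral.norm_integral_le_of_norm_le_const (a := -π) (b := π) (C := ‖f‖)
    (f := fun t : ℝ => f (Circle.exp t)) fun t _ => f.norm_coe_le_norm _
  rw [abs_of_pos (by linarith [pi_pos])] at this
  rw [circleMean]
  linarith

theorem integral_exp_pow_mul_conj (a b : ℕ) :
    ∫ t in (-π)..π, ((Circle.exp t : ℂ) ^ a * (starRingEnd ℂ) (Circle.exp t : ℂ) ^ b) =
      if a = b then (2 * π : ℂ) else 0 := by
  have e : ∀ t : ℝ, ((Circle.exp t : ℂ) ^ a * (starRingEnd ℂ) (Circle.exp t : ℂ) ^ b) =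
      Complex.exp ((((a : ℤ) - b : ℤ) : ℂ) * Complex.I * t) := by
    intro t
    rw [Circle.coe_exp, ← Complex.exp_conj, ← Complex.exp_nat_mul, ← Complex.exp_nat_mul,
      ← Complex.exp_add]
    congr 1
    simp
    ring
  simp_rw [e]
  split_ifs with h
  · subst h
    simp
    ring
  · have hab : ((a : ℤ) - b : ℤ) ≠ 0 := by omega
    rw [integral_exp_mul_complex (mul_ne_zero (by exact_mod_cast hab) Complex.I_ne_zero)]
    rw [div_eq_zero_iff, sub_eq_zero]
    left
    rw [Complex.exp_eq_exp_iff_exists_int]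
    exact ⟨(a : ℤ) - b, by push_cast; ring⟩

theorem circleMean_monomial (μ ν : List (Fin n)) :
    circleMean (wordIsometry (gaugeFamily S) μ * star (wordIsometry (gaugeFamily S) ν)) =
      if μ.length = ν.length then
        (2 * π : ℂ) • (wordIsometry S μ * star (wordIsometry S ν)) else 0 := by
  have e : ∀ t : ℝ, (wordIsometry (gaugeFamily S) μ * star (wordIsometry (gaugeFamily S) ν))
      (Circle.exp t) = ((Circle.exp t : ℂ) ^ μ.length *
        (starRingEnd ℂ) (Circle.exp t : ℂ) ^ ν.length) •
          (wordIsometry S μ * star (wordIsometry S ν)) := by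
    intro t
    rw [ContinuousMap.mul_apply, ContinuousMap.star_apply, wordIsometry_gaugeFamily_apply,
      wordIsometry_gaugeFamily_apply, star_smul, smul_mul_smul_comm, star_pow, RCLike.star_def]
  rw [circleMean]
  simp_rw [e]
  rw [intervalIntegral.integral_smul_const, integral_exp_pow_mul_conj]
  split_ifs <;> simp

theorem IsCuntzFamily.exists_compress_eq_circleMean (hS : IsCuntzFamily S)
    (hO : IsOrthonormal S) {f : C(Circle, A)}
    (hf : f ∈ StarAlgebra.adjoin ℂ (Set.range (gaugeFamily S))) :
    ∃ k, ∀ m, k ≤ m → ∀ x, IsWandering S m x →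
      (2 * π : ℂ) • (star ((shift S)^[m] x) * f 1 * (shift S)^[m] x) = circleMean f := by
  refine hO.gaugeFamily.adjoin_induction (p := fun f : C(Circle, A) => ∃ k, ∀ m, k ≤ m →
    ∀ x, IsWandering S m x →
      (2 * π : ℂ) • (star ((shift S)^[m] x) * f 1 * (shift S)^[m] x) = circleMean f)
    (fun μ ν => ?_) ⟨0, fun m _ x _ => by simp [circleMean_zero]⟩ (fun f g hf hg => ?_)
    (fun c f hf => ?_) hf
  · refine ⟨max μ.length ν.length, fun m hm x hx => ?_⟩
    rw [circleMean_monomial, ContinuousMap.mul_apply, ContinuousMap.star_apply,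
      wordIsometry_gaugeFamily_apply, wordIsometry_gaugeFamily_apply, Circle.coe_one, one_pow,
      one_pow, one_smul, one_smul, hS.compress hO hx ((le_max_left _ _).trans hm)
      ((le_max_right _ _).trans hm), smul_ite, smul_zero]
  · obtain ⟨k, hk⟩ := hf
    obtain ⟨l, hl⟩ := hg
    refine ⟨max k l, fun m hm x hx => ?_⟩
    rw [circleMean_add, ← hk m ((le_max_left _ _).trans hm) x hx,
      ← hl m ((le_max_right _ _).trans hm) x hx, ContinuousMap.add_apply, mul_add, add_mul,
      smul_add]
  · obtain ⟨k, hk⟩ := hf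
    refine ⟨k, fun m hm x hx => ?_⟩
    rw [circleMean_smul, ← hk m hm x hx, ContinuousMap.smul_apply, mul_smul_comm,
      smul_mul_assoc, smul_comm]

theorem norm_le_one_of_star_mul_self {w : A} (hw : star w * w = 1) : ‖w‖ ≤ 1 := by
  rcases subsingleton_or_nontrivial A with h | h
  · simp [Subsingleton.elim w 0]
  · have := CStarRing.norm_star_mul_self (x := w)
    rw [hw, CStarRing.norm_one] at this
    nlinarith [norm_nonneg w]

/-- The mean is over all of f, but the hypothesis `h` concerns f(1) only: for approximating
polynomials the mean is a compression of the value at 1. It serves both for the injectivity of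
evaluation at 1 and for the final vanishing result. -/
theorem IsCuntzFamily.circleMean_eq_zero (hS : IsCuntzFamily S) (hO : IsOrthonormal S)
    {f : C(Circle, A)}
    (hf : f ∈ (StarAlgebra.adjoin ℂ (Set.range (gaugeFamily S))).topologicalClosure)
    (h : ∀ m, ∃ x, IsWandering S m x ∧ f 1 * (shift S)^[m] x = 0) : circleMean f = 0 := by
  rw [← norm_le_zero_iff]
  refine le_of_forall_pos_le_add fun ε hε => ?_
  rw [zero_add]
  -- The error 2π‖f - g‖ occurs twice: in the mean of f - g and in the compression of g(1), hence
  -- 4π.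
  obtain ⟨g, hg, hfg⟩ := Metric.mem_closure_iff.1
    (show f ∈ closure ((StarAlgebra.adjoin ℂ (Set.range (gaugeFamily S)) :
      StarSubalgebra ℂ C(Circle, A)) : Set C(Circle, A)) from hf) (ε / (4 * π)) (by positivity)
  rw [dist_eq_norm] at hfg
  obtain ⟨m, hm⟩ := hS.exists_compress_eq_circleMean hO hg
  obtain ⟨x, hx, hx0⟩ := h m
  have hgm := hm m le_rfl x hx
  set w := (shift S)^[m] x with hw
  have hww : star w * w = 1 := by
    rw [hw, ← iterate_shift_star, ← hO.iterate_shift_mul, hx.star_mul_self, hS.iterate_shift_one]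
  have hw1 := norm_le_one_of_star_mul_self hww
  have e1 : circleMean g = (2 * π : ℂ) • (star w * (g - f) 1 * w) := by
    rw [← hgm, ContinuousMap.sub_apply, mul_sub, sub_mul, mul_assoc _ (f 1), hx0, mul_zero,
      sub_zero]
  have n1 : ‖circleMean g‖ ≤ 2 * π * ‖f - g‖ := by
    have h2 : ‖star w * (g - f) 1 * w‖ ≤ ‖f - g‖ := by
      calc ‖star w * (g - f) 1 * w‖ ≤ ‖star w‖ * ‖(g - f) 1‖ * ‖w‖ :=
            (norm_mul_le _ _).trans (by gcongr; exact norm_mul_le _ _)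
        _ ≤ 1 * ‖g - f‖ * 1 := by
            gcongr
            · rwa [norm_star]
            · exact (g - f).norm_coe_le_norm 1
        _ = ‖f - g‖ := by rw [norm_sub_rev]; ring
    have h3 : ‖(2 * π : ℂ)‖ = 2 * π := by simp [abs_of_pos pi_pos]
    rw [e1, norm_smul, h3]
    gcongr
  have n2 := norm_circleMean_le (f - g)
  have e2 : circleMean f = circleMean (f - g) + circleMean g := by
    rw [← circleMean_add, sub_add_cancel]
  have h4 : 4 * π * ‖f - g‖ ≤ ε := by
    have := (lt_div_iff₀ (by positivity)).1 hfg
    linarith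
  calc ‖circleMean f‖ ≤ ‖circleMean (f - g)‖ + ‖circleMean g‖ := e2 ▸ norm_add_le _ _
    _ ≤ ε := by linarith

/-- The mean over the circle is faithful. -/
theorem eq_zero_of_circleMean_star_mul_self [PartialOrder A] [StarOrderedRing A]
    {f : C(Circle, A)} (hf : circleMean (star f * f) = 0) : f = 0 := by
  have hcont := continuous_comp_exp (star f * f)
  have hnn : ∀ t : ℝ, 0 ≤ (star f * f) (Circle.exp t) := fun t => star_mul_self_nonneg _
  have hint : ∀ a b : ℝ, IntervalIntegrable (fun t => (star f * f) (Circle.exp t)) volume a b :=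
    fun a b => hcont.intervalIntegrable a b
  have hint_nn : ∀ {a b : ℝ}, a ≤ b → 0 ≤ ∫ t in a..b, (star f * f) (Circle.exp t) := by
    intro a b hab
    rw [intervalIntegral.integral_of_le hab]
    exact integral_nonneg hnn
  -- By positivity the primitive lies between 0 and the full integral 0. Its derivative, the
  -- A-valued integrand, therefore vanishes.
  have hzero : ∀ s ∈ Set.Icc (-π) π, ∫ t in (-π)..s, (star f * f) (Circle.exp t) = 0 := by
    intro s hs
    refine le_antisymm ?_ (hint_nn hs.1)
    rw [← hf, circleMean, ← intervalIntegral.integral_add_adjacent_intervals (hint (-π) s) (hint s π)]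
    exact le_add_of_nonneg_right (hint_nn hs.2)
  have hIoo : ∀ s ∈ Set.Ioo (-π) π, (star f * f) (Circle.exp s) = 0 := by
    intro s hs
    have h1 := intervalIntegral.integral_hasDerivAt_right (hint (-π) s)
      (hcont.stronglyMeasurableAtFilter _ _) hcont.continuousAt
    have h2 : HasDerivAt (fun u : ℝ => ∫ t in (-π)..u, (star f * f) (Circle.exp t)) 0 s := by
      refine (hasDerivAt_const s (0 : A)).congr_of_eventuallyEq ?_
      filter_upwards [Ioo_mem_nhds hs.1 hs.2] with u hu
      exact hzero u ⟨hu.1.le, hu.2.le⟩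
    exact h1.unique h2
  have hIcc : Set.Icc (-π) π ⊆ {s : ℝ | (star f * f) (Circle.exp s) = 0} := by
    rw [← closure_Ioo (by linarith [pi_pos])]
    exact closure_minimal hIoo (isClosed_eq hcont continuous_const)
  ext z
  have := hIcc ⟨(Complex.neg_pi_lt_arg (z : ℂ)).le, Complex.arg_le_pi (z : ℂ)⟩
  rw [Set.mem_ofPred_eq, Circle.exp_arg] at this
  exact CStarRing.star_mul_self_eq_zero_iff _ |>.1 this

/-- Every element of the Cuntz algebra is the value at `1` of an element of the
C⋆-algebra generated by the gauge family. -/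
theorem IsCuntzFamily.exists_gauge_lift [PartialOrder A] [StarOrderedRing A] (hn : 2 ≤ n)
    (hS : IsCuntzFamily S) (a : A) :
    ∃ f ∈ (StarAlgebra.adjoin ℂ (Set.range (gaugeFamily S))).topologicalClosure, f 1 = a := by
  have hO := hS.isOrthonormal
  set B := (StarAlgebra.adjoin ℂ (Set.range (gaugeFamily S))).topologicalClosure with hB
  have hBc : IsClosed (B : Set C(Circle, A)) := StarSubalgebra.isClosed_topologicalClosure _
  let _ : CStarAlgebra B := StarSubalgebra.cstarAlgebra B (h_closed := hBc)
  let φ : B →⋆ₐ[ℂ] A :=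
    { toFun := fun f => (f : C(Circle, A)) 1
      map_one' := rfl
      map_mul' := fun _ _ => rfl
      map_zero' := rfl
      map_add' := fun _ _ => rfl
      commutes' := fun _ => rfl
      map_star' := fun _ => rfl }
  -- If f(1) = 0, every wandering isometry meets the condition of `circleMean_eq_zero` for f⋆f, and
  -- the mean is faithful.
  have hφ : Function.Injective φ := by
    refine (injective_iff_map_eq_zero φ).2 fun f hf => ?_
    have hf1 : (f : C(Circle, A)) 1 = 0 := hf
    have hmean : circleMean (star (f : C(Circle, A)) * (f : C(Circle, A))) = 0 := by
      refine hS.circleMean_eq_zero hO (mul_mem (star_mem f.2) f.2) fun m => ?_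
      have h0 : (star (f : C(Circle, A)) * (f : C(Circle, A))) 1 = 0 := by
        rw [ContinuousMap.mul_apply, hf1, mul_zero]
      rw [h0]
      exact hO.exists_isWandering hn (fun μ => ⟨[], zero_mul _⟩) m
    exact Subtype.ext (eq_zero_of_circleMean_star_mul_self hmean)
  have hiso : Isometry φ := NonUnitalStarAlgHom.isometry φ hφ
  -- An injective ⋆-homomorphism is isometric, so its range is closed; as it contains all S_i, it is
  -- everything.
  have hclosed : IsClosed (φ.range : Set A) := by
    exact hiso.isClosedEmbedding.isClosed_range
  have htop : φ.range = ⊤ := by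
    rw [eq_top_iff, ← hS.generates]
    refine StarSubalgebra.topologicalClosure_minimal (StarAlgebra.adjoin_le ?_) hclosed
    rintro _ ⟨i, rfl⟩
    refine ⟨⟨gaugeFamily S i, StarSubalgebra.le_topologicalClosure _
      (StarAlgebra.subset_adjoin ℂ _ ⟨i, rfl⟩)⟩, ?_⟩
    change gaugeFamily S i 1 = S i
    rw [gaugeFamily_apply, Circle.coe_one, one_smul]
  obtain ⟨f, hf⟩ : a ∈ φ.range := htop ▸ StarSubalgebra.mem_top
  exact ⟨f, f.2, hf⟩

/-- An element of the Cuntz algebra that annihilates a dense family of cylinders vanishes. -/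
theorem IsCuntzFamily.eq_zero_of_forall_exists_mul_eq_zero [PartialOrder A] [StarOrderedRing A]
    (hn : 2 ≤ n) (hS : IsCuntzFamily S) {a : A}
    (ha : ∀ μ : List (Fin n), ∃ σ, a * wordIsometry S (μ ++ σ) = 0) : a = 0 := by
  have hO := hS.isOrthonormal
  obtain ⟨f, hf, rfl⟩ := hS.exists_gauge_lift hn a
  have : circleMean (star f * f) = 0 := by
    refine hS.circleMean_eq_zero hO (mul_mem (star_mem hf) hf) fun m => ?_
    obtain ⟨x, hx, hx0⟩ := hO.exists_isWandering hn ha m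
    exact ⟨x, hx, by rw [ContinuousMap.mul_apply, mul_assoc, hx0, mul_zero]⟩
  rw [eq_zero_of_circleMean_star_mul_self this, ContinuousMap.zero_apply]

end Gauge

/-! ### Decreasing cylinders and the equivalence. -/

theorem concat_succ {n : ℕ} (ν : ℕ → List (Fin n)) (k : ℕ) :
    concat ν (k + 1) = concat ν k ++ ν (k + 1) := by
  simp [concat, List.range_succ (n := k + 1)]

variable {A : Type*} [CStarAlgebra A] [PartialOrder A] [StarOrderedRing A] {n : ℕ} {S : Fin n → A}

theorem IsOrthonormal.antitone_map_concat (hO : IsOrthonormal S) (α : A →⋆ₐ[ℂ] A)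
    (ν : ℕ → List (Fin n)) : Antitone fun k => α (wordProj S (concat ν k)) := by
  refine antitone_nat_of_succ_le fun k => ?_
  refine ((hO.isStarProjection _).map α).le_of_mul_eq_left ((hO.isStarProjection _).map α) ?_
  rw [← map_mul, concat_succ, hO.append_mul_proj]

end CuntzAlg

theorem proposition3p3 {A : Type*} [CStarAlgebra A] [PartialOrder A] [StarOrderedRing A]
    [Nontrivial A] {n : ℕ} (hn : 2 ≤ n) (S : Fin n → A) (hS : CuntzAlg.IsCuntzFamily S)
    (α : A →⋆ₐ[ℂ] A)
    (hα : ∀ x ∈ CuntzAlg.diagonal S, α x ∈ CuntzAlg.diagonal S) :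
    CuntzAlg.IsModestlyScaling S α ↔
      ∀ ν : ℕ → List (Fin n), (∀ k, ν k ≠ []) →
        Tendsto (fun k : ℕ => CuntzAlg.minLength S (α (CuntzAlg.wordProj S (CuntzAlg.concat ν k))))
          atTop atTop := by
  have hO := hS.isOrthonormal
  have hproj : ∀ μ, IsStarProjection (α (CuntzAlg.wordProj S μ)) :=
    fun μ => (hO.isStarProjection μ).map α
  have hdiag : ∀ μ, α (CuntzAlg.wordProj S μ) ∈ CuntzAlg.diagonal S :=
    fun μ => hα _ (CuntzAlg.wordProj_mem_diagonal μ)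
  refine forall_congr' fun ν => forall_congr' fun _ => ⟨fun h => ?_, fun h p hp hle => ?_⟩
  · rw [tendsto_atTop]
    intro L
    -- Finiteness of the set of words shorter than L makes one k serve for all of them; monotonicity
    -- in k makes each exclusion permanent.
    have hev : ∀ᶠ k in atTop, ∀ μ ∈ {μ : List (Fin n) | μ.length < L},
        ¬ CuntzAlg.wordProj S μ ≤ α (CuntzAlg.wordProj S (CuntzAlg.concat ν k)) := by
      rw [eventually_all_finite (List.finite_length_lt (Fin n) L)]
      intro μ _
      obtain ⟨k, hk⟩ : ∃ k,
          ¬ CuntzAlg.wordProj S μ ≤ α (CuntzAlg.wordProj S (CuntzAlg.concat ν k)) := by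
        by_contra! hall
        exact hO.wordProj_ne_zero μ (h _ (hO.isStarProjection μ) hall)
      filter_upwards [eventually_ge_atTop k] with l hl hle
      exact hk (hle.trans (hO.antitone_map_concat α ν hl))
    filter_upwards [hev] with k hk
    obtain ⟨μ, hlen, hle⟩ := hS.exists_wordProj_le (hdiag (CuntzAlg.concat ν k)) (hproj _)
      (hO.map_wordProj_ne_zero α _)
    rw [← hlen]
    by_contra! hlt
    exact hk μ hlt hle
  · refine hS.eq_zero_of_forall_exists_mul_eq_zero hn fun μ => ?_
    obtain ⟨k, hk⟩ := (h.eventually_gt_atTop μ.length).exists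
    set q := α (CuntzAlg.wordProj S (CuntzAlg.concat ν k)) with hq
    have hqμ : q * CuntzAlg.wordProj S μ ≠ CuntzAlg.wordProj S μ := fun hqμ =>
      absurd (hS.minLength_le (hdiag _) (hproj _) hqμ) (not_le.2 hk)
    obtain ⟨r, hr⟩ := hO.exists_level (hdiag (CuntzAlg.concat ν k)) (hproj _)
    obtain ⟨σ, hσ⟩ := hS.exists_append_mul_eq_zero r μ
      (fun σ hσ => hr (μ ++ σ) (by simp [hσ])) hqμ
    refine ⟨σ, ?_⟩
    -- From p = pq and q P_{μσ} = 0 it follows that p S_{μσ} = p q P_{μσ} S_{μσ} = 0.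
    have hpq : p * q = p := (hp.le_iff_mul_eq_left (hproj _)).1 (hle k)
    have hP : CuntzAlg.wordProj S (μ ++ σ) * CuntzAlg.wordIsometry S (μ ++ σ) =
        CuntzAlg.wordIsometry S (μ ++ σ) := by
      rw [CuntzAlg.wordProj, mul_assoc, hO.star_mul_self, mul_one]
    rw [← hP, ← mul_assoc, ← hpq, mul_assoc p, hσ, mul_zero, zero_mul]
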